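/- All topological groups are assumed to be Hausdorff. Let $X$ be an $\omega$-narrow topological group of countable pseudocharacter; that is, for every neighborhood $U$ of the unit in $X$ there is a countable set $C\subset X$ with $X=CU$, and for every point $x\in X$ there is a countable family $\mathcal U$ of open subsets of $X$ with $\bigcap\mathcal U=\{x\}$. Then the following conditions are equivalent: 1. $X$ is Polish (its topology is separable and completely metrizable) and minimal; 2. $X$ is complete and minimal; 3. $X$ is $\mathsf{i{:}TG}$-closed, that is, for every injective continuous homomorphism $f:X\to Y$ to a topological group $Y$ the image $f(X)$ is closed in $Y$; 4. $X$ is $\mathsf{i{:}PG}$-closed, that is, for every injective continuous homomorphism $f:X\to Y$ to a Polish group $Y$ (a topological group whose topology is Polish) the image $f(X)$ is closed in $Y$. Here $X$ is called minimal if every continuous bijective homomorphism from $X$ to a topological group is open, and complete if it is complete in its two-sided uniformity, generated by the entourages $\{(x,y)\in X\times X: y\in xU\cap Ux\}$, where $U$ runs over the neighborhoods of the unit in $X$. -/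

import Mathlib

open Topology Pointwise

universe u

/-- Every point is the intersection of a countable family of open sets. -/
def HasCountablePseudocharacter (X : Type u) [TopologicalSpace X] : Prop :=
  ∀ x : X, ∃ 𝒰 : Set (Set X), 𝒰.Countable ∧ (∀ U ∈ 𝒰, IsOpen U) ∧ ⋂₀ 𝒰 = {x}

/-- A group with a topology is `ω`-narrow if for every neighbourhood `U` of the unit there is
a countable set `C` with `X = C U`. -/
def IsOmegaNarrow (X : Type u) [Group X] [TopologicalSpace X] : Prop :=
  ∀ U ∈ 𝓝 (1 : X), ∃ C : Set X, C.Countable ∧ C * U = Set.univ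

/-- The two-sided uniformity of a topological group, generated by the entourages
`{(x, y) | y ∈ x U ∩ U x}`, where `U` runs over the neighbourhoods of the unit. It is the
infimum (coarsest common refinement) of the left and the right uniformity. -/
@[reducible]
def twoSidedUniformSpace (X : Type u) [Group X] [TopologicalSpace X] [IsTopologicalGroup X] :
    UniformSpace X :=
  IsTopologicalGroup.leftUniformSpace X ⊓ IsTopologicalGroup.rightUniformSpace X

/-- A topological group is complete if it is complete in its two-sided uniformity. -/
def IsCompleteTopGroup (X : Type u) [Group X] [TopologicalSpace X] [IsTopologicalGroup X] :
    Prop :=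
  @CompleteSpace X (twoSidedUniformSpace X)

/-- The class of all Hausdorff topological groups. -/
def ClassTG (Y : Type u) [Group Y] [TopologicalSpace Y] : Prop :=
  IsTopologicalGroup Y ∧ T2Space Y

/-- The class of all Polish groups: topological groups whose topology is Polish. -/
def ClassPG (Y : Type u) [Group Y] [TopologicalSpace Y] : Prop :=
  IsTopologicalGroup Y ∧ PolishSpace Y

/-- A topological group is minimal if every continuous bijective homomorphism from it to a
Hausdorff topological group is open. -/
def IsMinimalTopGroup (X : Type u) [Group X] [TopologicalSpace X] : Prop :=
  ∀ (Y : Type u) [Group Y] [TopologicalSpace Y], ClassTG Y →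
    ∀ h : X →* Y, Continuous h → Function.Bijective h → IsOpenMap h

/-- `X` is `i:𝒞`-closed, for a class `𝒞` of groups with a topology, if for every injective
continuous homomorphism from `X` to a member of `𝒞` the image is closed. -/
def IsInjClosed (𝒞 : ∀ (Y : Type u) [Group Y] [TopologicalSpace Y], Prop)
    (X : Type u) [Group X] [TopologicalSpace X] : Prop :=
  ∀ (Y : Type u) [Group Y] [TopologicalSpace Y], 𝒞 Y →
    ∀ f : X →* Y, Continuous f → Function.Injective f → IsClosed (Set.range f)

/-!
The substantial implication is from closedness under injective homomorphisms to Polish groups to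
"Polish and minimal"; it rests on two facts.

* *Many injections into Polish groups.* If `X` is `ω`-narrow and `F` is a countably generated
  filter with `𝓝 1 ≤ F` and `⋂ F = {1}`, then there is a coarser second countable Hausdorff group
  topology on `X` whose neighbourhoods of `1` refine `F` (`IsOmegaNarrow.exists_coarser`):
  `ω`-narrowness lets countably many sets witness the conjugation axiom for all elements of `X` at
  once. The two-sided completion of a second countable Hausdorff group is a Polish group
  (`exists_polish_group_isInducing`). Countable pseudocharacter supplies such an `F`, and `F` may be
  shrunk by any prescribed neighbourhood of `1`.
* *Open mapping.* A continuous injective homomorphism between Polish groups with closed image is a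
  topological embedding (`MonoidHom.isInducing_of_isClosed_range`), by the Lusin–Souslin theorem
  and Pettis' theorem (`BaireMeasurableSet.mul_inv_mem_nhds_one`).

If all injective continuous images of `X` in Polish groups are closed, then all injections of `X`
into Polish groups induce one and the same topology: compare two of them with their product. By the
first fact these topologies together generate the topology of `X`, so `X` embeds as a closed subgroup
of a Polish group and is Polish. If `h : X → Z` is a continuous bijective homomorphism, then `Z` is
again `ω`-narrow and, as a Hausdorff continuous image of a second countable space, of countable
pseudocharacter; composing `h` with an injection of `Z` into a Polish group gives an embedding of
`X`, so `h` is an embedding too, hence open.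

Conversely, a Polish group is complete by a Baire category argument
(`exists_le_nhds_of_tendsto_inv_mul`), a minimal group is embedded by each of its injective
continuous homomorphisms, and an embedded complete group is closed.
-/

open Filter Set

/-! ### Second countable coarsenings of `ω`-narrow group topologies -/

section Coarsening

variable {X : Type u} [Group X] [t : TopologicalSpace X] [IsTopologicalGroup X]

/-- Let `X = C * W` with `C` countable and `W` a small symmetric neighbourhood of `1`. Inverting, each
`x` has the form `w * c⁻¹`, and conjugation by it takes `c * W * c⁻¹` to `w * W * w⁻¹ ⊆ U`. So the
countably many neighbourhoods `c * W * c⁻¹` handle all conjugations. -/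
theorem IsOmegaNarrow.exists_countable_conj (hn : IsOmegaNarrow X) {U : Set X}
    (hU : U ∈ 𝓝 (1 : X)) :
    ∃ S : Set (Set X), S.Countable ∧ (∀ V ∈ S, V ∈ 𝓝 (1 : X)) ∧
      (∃ V ∈ S, V * V ⊆ U ∧ V⁻¹ ⊆ U) ∧ ∀ x : X, ∃ V ∈ S, ∀ v ∈ V, x * v * x⁻¹ ∈ U := by
  obtain ⟨A, hAo, hA1, hAU⟩ := exists_open_nhds_one_mul_subset hU
  obtain ⟨B, hBo, hB1, hBA⟩ := exists_open_nhds_one_mul_subset (hAo.mem_nhds hA1)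
  have hB : B ∈ 𝓝 (1 : X) := hBo.mem_nhds hB1
  set W : Set X := B ∩ B⁻¹ with hW
  have hWn : W ∈ 𝓝 (1 : X) := inter_mem hB (inv_mem_nhds_one X hB)
  have hWinv : ∀ w ∈ W, w⁻¹ ∈ W := fun w hw => ⟨hw.2, by simpa using hw.1⟩
  have hB_A : B ⊆ A := fun b hb => hBA ⟨b, hb, 1, hB1, mul_one b⟩
  have hA_U : A ⊆ U := fun b hb => hAU ⟨b, hb, 1, hA1, mul_one b⟩
  obtain ⟨C, hC, hCW⟩ := hn W hWn
  refine ⟨insert W ((fun c : X => (fun v => c⁻¹ * v * c) ⁻¹' W) '' C),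
    (hC.image _).insert _, ?_, ⟨W, mem_insert _ _, ?_, ?_⟩, fun x => ?_⟩
  · rintro V (rfl | ⟨c, -, rfl⟩)
    · exact hWn
    · have : Tendsto (fun v => c⁻¹ * v * c) (𝓝 1) (𝓝 (c⁻¹ * 1 * c)) :=
        Continuous.tendsto (by fun_prop) 1
      exact this (by simpa using hWn)
  · exact (mul_subset_mul inter_subset_left inter_subset_left).trans (hBA.trans hA_U)
  · exact fun w hw => hA_U (hB_A (by simpa using hw.2))
  · obtain ⟨c, hc, w, hw, hcw⟩ : x⁻¹ ∈ C * W := hCW ▸ mem_univ _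
    refine ⟨_, mem_insert_of_mem _ ⟨c, hc, rfl⟩, fun v hv => ?_⟩
    obtain rfl : x = w⁻¹ * c⁻¹ := by rw [← inv_inv x, ← hcw]; simp
    have h1 : w⁻¹ * (c⁻¹ * v * c) * w ∈ U :=
      hAU ⟨_, hBA ⟨_, (hWinv w hw).1, _, hv.1, rfl⟩, _, hB_A hw.1, rfl⟩
    simpa [mul_assoc] using h1

theorem IsOmegaNarrow.exists_filter_refinement (hn : IsOmegaNarrow X) (F : Filter X)
    [F.IsCountablyGenerated] (hF : 𝓝 1 ≤ F) :
    ∃ F' : Filter X, F'.IsCountablyGenerated ∧ 𝓝 1 ≤ F' ∧ F' * F' ≤ F ∧ F'⁻¹ ≤ F ∧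
      ∀ x : X, map (fun v => x * v * x⁻¹) F' ≤ F := by
  obtain ⟨s, hs⟩ := F.exists_antitone_basis
  choose S hSc hSn hSm hSx using fun n => hn.exists_countable_conj (hF (hs.mem n))
  have hmem : ∀ n, ∀ V ∈ S n, V ∈ generate (⋃ n, S n) := fun n V hV =>
    mem_generate_of_mem (mem_iUnion_of_mem n hV)
  refine ⟨generate (⋃ n, S n), ⟨_, countable_iUnion hSc, rfl⟩, ?_, ?_, ?_, fun x => ?_⟩
  · refine le_generate_iff.2 (iUnion_subset fun n V hV => hSn n V hV)
  · refine hs.1.ge_iff.2 fun n _ => ?_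
    obtain ⟨V, hV, hVm, -⟩ := hSm n
    exact mem_of_superset (mul_mem_mul (hmem n V hV) (hmem n V hV)) hVm
  · refine hs.1.ge_iff.2 fun n _ => ?_
    obtain ⟨V, hV, -, hVi⟩ := hSm n
    exact mem_of_superset (inv_mem_inv (hmem n V hV)) hVi
  · refine hs.1.ge_iff.2 fun n _ => ?_
    obtain ⟨V, hV, hVx⟩ := hSx n x
    exact mem_map.2 (mem_of_superset (hmem n V hV) hVx)

/-- Iterating `IsOmegaNarrow.exists_filter_refinement` and taking the infimum gives a countably
generated filter that satisfies the axioms of the neighbourhood filter of `1` in a group. -/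
theorem IsOmegaNarrow.exists_invariant_filter (hn : IsOmegaNarrow X) (F : Filter X)
    [F.IsCountablyGenerated] (hF : 𝓝 1 ≤ F) :
    ∃ N : Filter X, N.IsCountablyGenerated ∧ 𝓝 1 ≤ N ∧ N ≤ F ∧ N * N ≤ N ∧ N⁻¹ ≤ N ∧
      ∀ x : X, map (fun v => x * v * x⁻¹) N ≤ N := by
  choose! step hc h1 hm hi hx using fun (G : Filter X) (hG : G.IsCountablyGenerated ∧ 𝓝 1 ≤ G) =>
    @IsOmegaNarrow.exists_filter_refinement X _ _ _ hn G hG.1 hG.2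
  have hseq : ∀ n, (step^[n] F).IsCountablyGenerated ∧ 𝓝 1 ≤ step^[n] F := fun n => by
    induction n with
    | zero => exact ⟨‹_›, hF⟩
    | succ n ih =>
      rw [Function.iterate_succ_apply']
      exact ⟨hc _ ih, h1 _ ih⟩
  have hcg : ∀ n, (step^[n] F).IsCountablyGenerated := fun n => (hseq n).1
  refine ⟨⨅ n, step^[n] F, inferInstance, le_iInf fun n => (hseq n).2, iInf_le _ 0,
    le_iInf fun n => ?_, le_iInf fun n => ?_, fun x => le_iInf fun n => ?_⟩
  · refine le_trans ?_ (hm _ (hseq n))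
    rw [← Function.iterate_succ_apply' step]
    exact mul_le_mul' (iInf_le _ _) (iInf_le _ _)
  · refine le_trans ?_ (hi _ (hseq n))
    rw [← Function.iterate_succ_apply' step]
    exact Filter.inv_le_inv (iInf_le _ _)
  · refine le_trans ?_ (hx _ (hseq n) x)
    rw [← Function.iterate_succ_apply' step]
    exact map_mono (iInf_le _ _)

theorem IsOmegaNarrow.secondCountableTopology (hn : IsOmegaNarrow X)
    [(𝓝 (1 : X)).IsCountablyGenerated] : SecondCountableTopology X := by
  obtain ⟨s, hs⟩ := (𝓝 (1 : X)).exists_antitone_basis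
  choose C hC hCs using fun n => hn (s n) (hs.mem n)
  let := IsTopologicalGroup.leftUniformSpace X
  have : (uniformity X).IsCountablyGenerated :=
    inferInstanceAs (comap (fun p : X × X => p.1⁻¹ * p.2) (𝓝 1)).IsCountablyGenerated
  have : TopologicalSpace.SeparableSpace X := by
    refine ⟨⋃ n, C n, countable_iUnion hC, fun x => mem_closure_iff_nhds.2 fun t ht => ?_⟩
    have : Tendsto (fun u => x * u⁻¹) (𝓝 1) (𝓝 (x * 1⁻¹)) :=
      Continuous.tendsto (by fun_prop) 1
    obtain ⟨n, -, hn⟩ := hs.1.mem_iff.1 (this (by simpa using ht))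
    obtain ⟨c, hc, u, hu, hcu⟩ : x ∈ C n * s n := hCs n ▸ mem_univ _
    refine ⟨c, ?_, mem_iUnion_of_mem n hc⟩
    simpa [← hcu] using hn hu
  exact UniformSpace.secondCountable_of_separable X

/-- Guran's theorem in filter form: a countably generated filter that separates `1` from all other
points is refined by the neighbourhoods of `1` in a coarser second countable Hausdorff group
topology. -/
theorem IsOmegaNarrow.exists_coarser (hn : IsOmegaNarrow X) (F : Filter X)
    [F.IsCountablyGenerated] (hF : 𝓝 1 ≤ F) (hker : F.ker ⊆ {1}) :
    ∃ τ : TopologicalSpace X, @IsTopologicalGroup X τ _ ∧ @T2Space X τ ∧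
      @SecondCountableTopology X τ ∧ t ≤ τ ∧ @nhds X τ 1 ≤ F := by
  obtain ⟨N, hNc, hN1, hNF, hNm, hNi, hNx⟩ := hn.exists_invariant_filter F hF
  let B : GroupFilterBasis X :=
    { sets := N.sets
      nonempty := ⟨univ, univ_mem⟩
      inter_sets := fun {x y} hx hy => ⟨x ∩ y, inter_mem hx hy, Subset.rfl⟩
      one' := fun {U} hU => mem_of_mem_nhds (hN1 hU)
      mul' := fun {U} hU => by
        obtain ⟨A, hA, B, hB, hAB⟩ := Filter.mem_mul.1 (hNm hU)
        exact ⟨A ∩ B, inter_mem hA hB,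
          (mul_subset_mul inter_subset_left inter_subset_right).trans hAB⟩
      inv' := fun {U} hU => ⟨_, hNi hU, Subset.rfl⟩
      conj' := fun x {U} hU => ⟨_, hNx x hU, Subset.rfl⟩ }
  have hB : @nhds X B.topology 1 = N := by
    rw [B.nhds_one_eq]
    ext U
    exact ⟨fun ⟨V, hV, hVU⟩ => mem_of_superset hV hVU, fun hU => ⟨U, hU, Subset.rfl⟩⟩
  have hgrp := B.isTopologicalGroup
  refine ⟨B.topology, hgrp, ?_, ?_, ?_, hB.trans_le hNF⟩
  · rw [@GroupFilterBasis.t2Space_iff_sInter_subset X _ B.topology B rfl]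
    exact fun x hx => hker (mem_ker.2 fun s hs => hx s (hNF hs))
  · have hn' : @IsOmegaNarrow X _ B.topology := fun U hU => hn U (hN1 (hB ▸ hU))
    have : (@nhds X B.topology 1).IsCountablyGenerated := hB ▸ hNc
    exact @IsOmegaNarrow.secondCountableTopology X _ B.topology hgrp hn' this
  · refine le_of_nhds_le_nhds fun x => ?_
    rw [B.nhds_eq, ← map_mul_left_nhds_one x]
    exact map_mono (hN1.trans_eq (hB.symm.trans B.nhds_one_eq))

end Coarsening

/-! ### The completion of a second countable group -/

section Completion

open UniformSpace

variable {Z : Type u} [Group Z]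

/-- Products of left Cauchy families are left Cauchy. As `(x y)⁻¹ (x' y') = y⁻¹ (x⁻¹ x') y'`, one
fixes `y₀` far out in the second family and moves `x⁻¹ x'` close to `1` depending on `y₀`. Hence
multiplication preserves Cauchy filters although it need not be uniformly continuous. -/
theorem tendsto_inv_mul_mul [TopologicalSpace Z] [IsTopologicalGroup Z] {α β : Type*}
    {l : Filter α} {m : Filter β} [m.NeBot] {a : α → Z} {b : β → Z}
    (ha : Tendsto (fun p : α × α => (a p.1)⁻¹ * a p.2) (l ×ˢ l) (𝓝 1))
    (hb : Tendsto (fun p : β × β => (b p.1)⁻¹ * b p.2) (m ×ˢ m) (𝓝 1)) :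
    Tendsto (fun p : (α × β) × (α × β) => (a p.1.1 * b p.1.2)⁻¹ * (a p.2.1 * b p.2.2))
      ((l ×ˢ m) ×ˢ (l ×ˢ m)) (𝓝 1) := by
  intro U hU
  have h3 : Tendsto (fun p : Z × Z × Z => p.1⁻¹ * p.2.1 * p.2.2) (𝓝 1 ×ˢ 𝓝 1 ×ˢ 𝓝 1) (𝓝 1) := by
    have : Continuous fun p : Z × Z × Z => p.1⁻¹ * p.2.1 * p.2.2 := by fun_prop
    simpa [nhds_prod_eq] using this.tendsto (1, 1, 1)
  obtain ⟨V, hV, hVU⟩ : ∃ V ∈ 𝓝 (1 : Z), ∀ x ∈ V, ∀ y ∈ V, ∀ z ∈ V, x⁻¹ * y * z ∈ U := by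
    obtain ⟨V₁, h₁, W, hW, hVW⟩ := mem_prod_iff.1 (h3 hU)
    obtain ⟨V₂, h₂, V₃, h₃, hV₂₃⟩ := mem_prod_iff.1 hW
    exact ⟨V₁ ∩ (V₂ ∩ V₃), inter_mem h₁ (inter_mem h₂ h₃), fun x hx y hy z hz =>
      hVW (show (x, y, z) ∈ V₁ ×ˢ W from ⟨hx.1, hV₂₃ ⟨hy.2.1, hz.2.2⟩⟩)⟩
  obtain ⟨B, hB, hBV⟩ := mem_prod_same_iff.1 (hb hV)
  obtain ⟨y₀, hy₀⟩ := m.nonempty_of_mem hB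
  have hD : (fun t => (b y₀)⁻¹ * t * b y₀) ⁻¹' V ∈ 𝓝 (1 : Z) := by
    have : Continuous fun t => (b y₀)⁻¹ * t * b y₀ := by fun_prop
    exact this.tendsto 1 (by simpa using hV)
  obtain ⟨A, hA, hAD⟩ := mem_prod_same_iff.1 (ha hD)
  refine mem_map.2
    (mem_of_superset (prod_mem_prod (prod_mem_prod hA hB) (prod_mem_prod hA hB)) ?_)
  rintro ⟨⟨x, y⟩, x', y'⟩ ⟨⟨hx, hy⟩, hx', hy'⟩
  have h := hVU _ (hBV (mk_mem_prod hy₀ hy)) _ (hAD (mk_mem_prod hx hx')) _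
    (hBV (mk_mem_prod hy₀ hy'))
  simpa [mul_assoc] using h

variable [UniformSpace Z] [IsTopologicalGroup Z]

theorem tendsto_uniformity_iff_of_eq_twoSided
    (hZ : ‹UniformSpace Z› = twoSidedUniformSpace Z) {α : Type*} {l : Filter α} {f g : α → Z} :
    Tendsto (fun p => (f p, g p)) l (uniformity Z) ↔
      Tendsto (fun p => (f p)⁻¹ * g p) l (𝓝 1) ∧ Tendsto (fun p => g p * (f p)⁻¹) l (𝓝 1) := by
  have : uniformity Z = comap (fun p : Z × Z => p.1⁻¹ * p.2) (𝓝 1) ⊓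
      comap (fun p : Z × Z => p.2 * p.1⁻¹) (𝓝 1) := by
    conv_lhs => rw [hZ]
    rfl
  rw [this, tendsto_inf, tendsto_comap_iff, tendsto_comap_iff]
  rfl

theorem Cauchy.map_mul_of_eq_twoSided (hZ : ‹UniformSpace Z› = twoSidedUniformSpace Z)
    {f g : Filter Z} (hf : Cauchy f) (hg : Cauchy g) :
    Cauchy (map (fun p : Z × Z => p.1 * p.2) (f ×ˢ g)) := by
  have := hf.1
  have := hg.1
  have hf' := (tendsto_uniformity_iff_of_eq_twoSided hZ (f := Prod.fst) (g := Prod.snd)).1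
    (tendsto_id.mono_left hf.2)
  have hg' := (tendsto_uniformity_iff_of_eq_twoSided hZ (f := Prod.fst) (g := Prod.snd)).1
    (tendsto_id.mono_left hg.2)
  rw [cauchy_map_iff]
  refine ⟨inferInstance, (tendsto_uniformity_iff_of_eq_twoSided hZ).2
    ⟨tendsto_inv_mul_mul (a := id) (b := id) hf'.1 hg'.1, ?_⟩⟩
  have hswap : Tendsto (fun p : (Z × Z) × (Z × Z) => (p.2.swap, p.1.swap))
      ((f ×ˢ g) ×ˢ (f ×ˢ g)) ((g ×ˢ f) ×ˢ (g ×ˢ f)) :=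
    (tendsto_prod_swap.comp tendsto_snd).prodMk (tendsto_prod_swap.comp tendsto_fst)
  have h := (tendsto_inv_mul_mul (l := g) (m := f) (a := fun y => y⁻¹) (b := fun x => x⁻¹)
    (by simpa [Function.comp_def] using hg'.2.comp tendsto_prod_swap)
    (by simpa [Function.comp_def] using hf'.2.comp tendsto_prod_swap)).comp hswap
  simpa [Function.comp_def] using h

theorem uniformContinuous_inv_of_eq_twoSided
    (hZ : ‹UniformSpace Z› = twoSidedUniformSpace Z) :
    UniformContinuous fun z : Z => z⁻¹ := by
  have h := (tendsto_uniformity_iff_of_eq_twoSided hZ (f := Prod.snd) (g := Prod.fst)).1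
    (tendsto_swap_uniformity (α := Z))
  exact (tendsto_uniformity_iff_of_eq_twoSided hZ).2 ⟨by simpa using h.2, by simpa using h.1⟩

/-- Multiplication extends to the completion for the two-sided uniformity, because it maps products
of Cauchy filters to Cauchy filters. -/
theorem exists_continuous_mul_completion (hZ : ‹UniformSpace Z› = twoSidedUniformSpace Z) :
    ∃ m : Completion Z × Completion Z → Completion Z, Continuous m ∧
      ∀ a b : Z, m (a, b) = ((a * b : Z) : Completion Z) := by
  have di := (Completion.isDenseInducing_coe (α := Z)).prodMap
    (Completion.isDenseInducing_coe (α := Z))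
  have hc : Continuous fun p : Z × Z => ((p.1 * p.2 : Z) : Completion Z) :=
    (Completion.continuous_coe Z).comp continuous_mul
  refine ⟨di.extend fun p => ((p.1 * p.2 : Z) : Completion Z),
    di.continuous_extend_of_cauchy ?_, fun a b => di.extend_eq hc (a, b)⟩
  have hcau : ∀ x : Completion Z, Cauchy (comap ((↑) : Z → Completion Z) (𝓝 x)) := fun x => by
    have := Completion.isDenseInducing_coe.comap_nhds_neBot x
    exact cauchy_nhds.comap (Completion.isUniformInducing_coe Z).comap_uniformity.le
  rintro ⟨x, y⟩
  have h := (Cauchy.map_mul_of_eq_twoSided hZ (hcau x) (hcau y)).map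
    (Completion.uniformContinuous_coe Z)
  rw [nhds_prod_eq]
  rwa [prod_comap_comap_eq, Filter.map_map] at h

theorem exists_polish_group_isInducing_of_eq_twoSided [T2Space Z] [SecondCountableTopology Z]
    (hZ : ‹UniformSpace Z› = twoSidedUniformSpace Z) :
    ∃ (Y : Type u) (_ : Group Y) (_ : TopologicalSpace Y), ClassPG Y ∧
      ∃ i : Z →* Y, IsInducing i ∧ Function.Injective i := by
  obtain ⟨m, hm, hmc⟩ := exists_continuous_mul_completion hZ
  obtain ⟨v, hv, hvc⟩ : ∃ v : Completion Z → Completion Z, Continuous v ∧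
      ∀ a : Z, v a = ((a⁻¹ : Z) : Completion Z) :=
    ⟨Completion.map fun z => z⁻¹, Completion.continuous_map,
      fun a => Completion.map_coe (uniformContinuous_inv_of_eq_twoSided hZ) a⟩
  let grp : Group (Completion Z) :=
    { mul := fun a b => m (a, b)
      one := ((1 : Z) : Completion Z)
      inv := v
      mul_assoc := fun a b c => by
        change m (m (a, b), c) = m (a, m (b, c))
        refine Completion.induction_on₃ a b c (isClosed_eq (by fun_prop) (by fun_prop)) ?_
        intro a b c
        simp only [hmc, mul_assoc]
      one_mul := fun a => by
        change m (((1 : Z) : Completion Z), a) = a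
        refine Completion.induction_on a (isClosed_eq (by fun_prop) (by fun_prop)) fun a => ?_
        simp only [hmc, one_mul]
      mul_one := fun a => by
        change m (a, ((1 : Z) : Completion Z)) = a
        refine Completion.induction_on a (isClosed_eq (by fun_prop) (by fun_prop)) fun a => ?_
        simp only [hmc, mul_one]
      inv_mul_cancel := fun a => by
        change m (v a, a) = ((1 : Z) : Completion Z)
        refine Completion.induction_on a (isClosed_eq (by fun_prop) (by fun_prop)) fun a => ?_
        simp only [hmc, hvc, inv_mul_cancel] }
  have : (uniformity Z).IsCountablyGenerated := by
    rw [hZ]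
    exact inferInstanceAs (comap (fun p : Z × Z => p.1⁻¹ * p.2) (𝓝 1) ⊓
      comap (fun p : Z × Z => p.2 * p.1⁻¹) (𝓝 1)).IsCountablyGenerated
  have : (uniformity (Completion Z)).IsCountablyGenerated := by
    -- A compatible pseudometric on `Z` makes its completion a metric space with the same uniformity.
    let := UniformSpace.pseudoMetricSpace Z
    infer_instance
  exact ⟨Completion Z, grp, inferInstance,
    ⟨{ continuous_mul := hm, continuous_inv := hv }, inferInstance⟩,
    ⟨⟨((↑) : Z → Completion Z), rfl⟩, fun a b => (hmc a b).symm⟩,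
    (Completion.isUniformInducing_coe Z).isInducing, Completion.coe_injective Z⟩

end Completion

theorem twoSidedUniformSpace_toTopologicalSpace (Z : Type u) [Group Z] [τ : TopologicalSpace Z]
    [IsTopologicalGroup Z] :
    (twoSidedUniformSpace Z).toTopologicalSpace = τ :=
  inf_idem τ

/-- A second countable Hausdorff group embeds into a Polish group, its two-sided completion. -/
theorem exists_polish_group_isInducing (Z : Type u) [Group Z] [τ : TopologicalSpace Z]
    [hg : IsTopologicalGroup Z] [T2Space Z] [SecondCountableTopology Z] :
    ∃ (Y : Type u) (_ : Group Y) (_ : TopologicalSpace Y), ClassPG Y ∧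
      ∃ i : Z →* Y, IsInducing i ∧ Function.Injective i := by
  obtain ⟨U, hU⟩ : ∃ U, U = twoSidedUniformSpace Z := ⟨_, rfl⟩
  obtain rfl : U.toTopologicalSpace = τ := hU ▸ twoSidedUniformSpace_toTopologicalSpace Z
  exact exists_polish_group_isInducing_of_eq_twoSided hU

/-! ### Completeness of Polish groups -/

section PolishComplete

/-- A completely metrizable group is complete in the two-sided uniformity. For a Cauchy filter `F`,
the set `G k` of those `w` for which `W * A` has diameter at most `1 / (k + 1)` for some open `W`
around `w` and some `A ∈ F` is open and dense. By Baire some `x` lies in all `G k`; then the translate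
`x * F` is Cauchy for the complete metric, so it converges, and so does `F`. -/
theorem exists_le_nhds_of_tendsto_inv_mul {Z : Type*} [Group Z] [TopologicalSpace Z]
    [IsTopologicalGroup Z] [TopologicalSpace.IsCompletelyMetrizableSpace Z] {F : Filter Z} [F.NeBot]
    (hl : Tendsto (fun p : Z × Z => p.1⁻¹ * p.2) (F ×ˢ F) (𝓝 1))
    (hr : Tendsto (fun p : Z × Z => p.2 * p.1⁻¹) (F ×ˢ F) (𝓝 1)) : ∃ z, F ≤ 𝓝 z := by
  let := TopologicalSpace.upgradeIsCompletelyMetrizable Z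
  let G : ℕ → Set Z := fun k => {w | ∃ W : Set Z, IsOpen W ∧ w ∈ W ∧ ∃ A ∈ F, ∀ p ∈ W * A,
    ∀ q ∈ W * A, dist p q < 1 / ((k : ℝ) + 1)}
  have hGo : ∀ k, IsOpen (G k) := fun k => isOpen_iff_mem_nhds.2 fun w ⟨W, hW, hw, hA⟩ =>
    mem_of_superset (hW.mem_nhds hw) fun w' hw' => ⟨W, hW, hw', hA⟩
  have hGd : ∀ k, Dense (G k) := fun k => dense_iff_inter_open.2 fun V hV ⟨x, hx⟩ => by
    have hU : (fun u => x * u) ⁻¹' V ∈ 𝓝 (1 : Z) :=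
      (continuous_const_mul x).tendsto 1 (by simpa using hV.mem_nhds hx)
    obtain ⟨A₀, hA₀, hA₀U⟩ := mem_prod_same_iff.1 (hr hU)
    obtain ⟨a₀, ha₀⟩ := F.nonempty_of_mem hA₀
    have hpos : (0 : ℝ) < 1 / ((k : ℝ) + 1) := by positivity
    have hO : (fun t => x * a₀ * t) ⁻¹' Metric.ball (x * a₀) (1 / ((k : ℝ) + 1) / 2) ∈
        𝓝 (1 : Z) :=
      (continuous_const_mul (x * a₀)).tendsto 1
        (by simpa using Metric.ball_mem_nhds (x * a₀) (half_pos hpos))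
    obtain ⟨U₁, hU₁o, hU₁1, hU₁⟩ := exists_open_nhds_one_mul_subset hO
    obtain ⟨A₁, hA₁, hA₁U⟩ := mem_prod_same_iff.1 (hl (hU₁o.mem_nhds hU₁1))
    obtain ⟨a, ha0, ha1⟩ := F.nonempty_of_mem (inter_mem hA₀ hA₁)
    -- With `p = x * a₀`, the point of `V ∩ G k` is `p * a⁻¹`: right Cauchyness puts it into `V`, while
    -- left Cauchyness keeps its products with `A₁` close to `p`, which was fixed before `a`.
    have hWA : ∀ p ∈ (fun y => (x * a₀)⁻¹ * y * a) ⁻¹' U₁ * A₁,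
        dist p (x * a₀) < 1 / ((k : ℝ) + 1) / 2 := by
      rintro _ ⟨y, hy, b, hb, rfl⟩
      have := hU₁ (mul_mem_mul hy (hA₁U (mk_mem_prod ha1 hb)))
      simpa [mul_assoc] using this
    refine ⟨x * a₀ * a⁻¹, ?_, (fun y => (x * a₀)⁻¹ * y * a) ⁻¹' U₁,
      hU₁o.preimage (by fun_prop), by simpa [mul_assoc] using hU₁1, A₁, hA₁, fun p hp q hq => ?_⟩
    · have : x * (a₀ * a⁻¹) ∈ V := hA₀U (mk_mem_prod ha0 ha₀)
      rwa [mul_assoc]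
    · calc dist p q ≤ dist p (x * a₀) + dist q (x * a₀) := dist_triangle_right _ _ _
        _ < 1 / ((k : ℝ) + 1) := by linarith [hWA p hp, hWA q hq]
  obtain ⟨x, hx⟩ := (dense_iInter_of_isOpen_nat hGo hGd).nonempty
  have hc : Cauchy (map (fun z => x * z) F) := by
    refine Metric.cauchy_iff.2 ⟨inferInstance, fun ε hε => ?_⟩
    obtain ⟨k, hk⟩ := exists_nat_one_div_lt hε
    obtain ⟨W, -, hxW, A, hA, hWA⟩ := mem_iInter.1 hx k
    refine ⟨(fun z => x * z) '' A, image_mem_map hA, ?_⟩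
    rintro _ ⟨a, ha, rfl⟩ _ ⟨b, hb, rfl⟩
    exact (hWA _ (mul_mem_mul hxW ha) _ (mul_mem_mul hxW hb)).trans hk
  obtain ⟨z, hz⟩ := CompleteSpace.complete hc
  refine ⟨x⁻¹ * z, ?_⟩
  have h := (Tendsto.const_mul x⁻¹ (show Tendsto (fun z => x * z) F (𝓝 z) from hz))
  simpa [Tendsto] using h

/-- Completeness in terms of the group structure alone: filters that are both left and right Cauchy
converge. -/
theorem isCompleteTopGroup_iff {Z : Type*} [Group Z] [τ : TopologicalSpace Z]
    [IsTopologicalGroup Z] : IsCompleteTopGroup Z ↔ ∀ F : Filter Z, F.NeBot →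
      Tendsto (fun p : Z × Z => p.1⁻¹ * p.2) (F ×ˢ F) (𝓝 1) →
      Tendsto (fun p : Z × Z => p.2 * p.1⁻¹) (F ×ˢ F) (𝓝 1) → ∃ z, F ≤ 𝓝 z := by
  unfold IsCompleteTopGroup
  obtain ⟨U, hU⟩ : ∃ U, U = twoSidedUniformSpace Z := ⟨_, rfl⟩
  obtain rfl : U.toTopologicalSpace = τ := hU ▸ twoSidedUniformSpace_toTopologicalSpace Z
  have hcau : ∀ F : Filter Z, Cauchy F ↔ F.NeBot ∧
      Tendsto (fun p : Z × Z => p.1⁻¹ * p.2) (F ×ˢ F) (𝓝 1) ∧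
      Tendsto (fun p : Z × Z => p.2 * p.1⁻¹) (F ×ˢ F) (𝓝 1) := fun F =>
    and_congr_right' (by
      rw [← tendsto_uniformity_iff_of_eq_twoSided hU]
      exact tendsto_id'.symm)
  rw [← hU]
  exact ⟨fun h F h₁ h₂ h₃ => h.complete ((hcau F).2 ⟨h₁, h₂, h₃⟩),
    fun h => ⟨fun {F} hF => h F hF.1 ((hcau F).1 hF).2.1 ((hcau F).1 hF).2.2⟩⟩

theorem IsCompleteTopGroup.of_isCompletelyMetrizableSpace {Z : Type*} [Group Z]
    [TopologicalSpace Z] [IsTopologicalGroup Z] [TopologicalSpace.IsCompletelyMetrizableSpace Z] :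
    IsCompleteTopGroup Z :=
  isCompleteTopGroup_iff.2 fun _ _ => exists_le_nhds_of_tendsto_inv_mul

theorem IsCompleteTopGroup.isClosed_range {X Y : Type*} [Group X] [TopologicalSpace X]
    [IsTopologicalGroup X] [Group Y] [TopologicalSpace Y] [IsTopologicalGroup Y] [T2Space Y]
    (hX : IsCompleteTopGroup X) {f : X →* Y} (hf : IsInducing f) : IsClosed (range f) := by
  refine isClosed_iff_clusterPt.2 fun y hy => ?_
  have hne : (comap f (𝓝 y)).NeBot := comap_neBot_iff_frequently.2
    (mem_closure_iff_frequently.1 (mem_closure_iff_clusterPt.2 hy))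
  have hfy : Tendsto f (comap f (𝓝 y)) (𝓝 y) := tendsto_comap
  have h1 : 𝓝 (1 : X) = comap f (𝓝 1) := by rw [hf.nhds_eq_comap, map_one]
  obtain ⟨x, hx⟩ := isCompleteTopGroup_iff.1 hX (comap f (𝓝 y)) hne
    (by
      rw [h1, tendsto_comap_iff]
      simpa [Function.comp_def] using (hfy.comp tendsto_fst).inv.mul (hfy.comp tendsto_snd))
    (by
      rw [h1, tendsto_comap_iff]
      simpa [Function.comp_def] using (hfy.comp tendsto_snd).mul (hfy.comp tendsto_fst).inv)
  exact ⟨x, tendsto_nhds_unique ((hf.continuous.tendsto x).mono_left hx) hfy⟩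

theorem IsMinimalTopGroup.isInducing {X : Type u} [Group X] [TopologicalSpace X]
    (hX : IsMinimalTopGroup X) {Y : Type u} [Group Y] [TopologicalSpace Y]
    [IsTopologicalGroup Y] [T2Space Y] {f : X →* Y} (hf : Continuous f)
    (hinj : Function.Injective f) : IsInducing f := by
  have hc : Continuous f.rangeRestrict := hf.subtype_mk _
  have hi : Function.Injective f.rangeRestrict := f.rangeRestrict_injective_iff.2 hinj
  have ho := hX f.range ⟨inferInstance, inferInstance⟩ f.rangeRestrict hc
    ⟨hi, f.rangeRestrict_surjective⟩
  exact IsInducing.subtypeVal.comp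
    (IsOpenEmbedding.of_continuous_injective_isOpenMap hc hi ho).isInducing

end PolishComplete

/-! ### The open mapping theorem for Polish groups -/

section OpenMapping

/-- **Pettis' theorem**: if `A` is nonmeagre and has the Baire property, then `A * A⁻¹` is a
neighbourhood of `1`. -/
theorem BaireMeasurableSet.mul_inv_mem_nhds_one {G : Type*} [Group G] [TopologicalSpace G]
    [IsTopologicalGroup G] [BaireSpace G] {A : Set G} (hA : BaireMeasurableSet A)
    (hm : ¬ IsMeagre A) : A * A⁻¹ ∈ 𝓝 (1 : G) := by
  obtain ⟨u, hu, hAu⟩ := hA.residualEq_isOpen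
  have hne : u.Nonempty := by
    rw [nonempty_iff_ne_empty]
    rintro rfl
    refine hm ?_
    filter_upwards [hAu] with x hx hxA
    exact (eq_iff_iff.1 hx).1 hxA
  have huo : IsOpen (u * u⁻¹) := hu.mul_right
  obtain ⟨x₀, hx₀⟩ := hne
  refine mem_of_superset (huo.mem_nhds ⟨x₀, hx₀, x₀⁻¹, by simpa using hx₀, by simp⟩) ?_
  rintro _ ⟨a, ha, b, hb, rfl⟩
  set g := a * b with hg
  have ht : Tendsto (fun x => g⁻¹ * x) (residual G) (residual G) :=
    tendsto_residual_of_isOpenMap (continuous_const_mul _) (isOpenMap_mul_left _)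
  -- Generic points of `u ∩ g * u` lie in `A ∩ g * A`.
  have hd := dense_of_mem_residual (inter_mem hAu (ht hAu))
  obtain ⟨x, ⟨hxu, hgxu⟩, hxA, hgxA⟩ := hd.inter_open_nonempty
    (u ∩ (fun x => g⁻¹ * x) ⁻¹' u) (hu.inter (hu.preimage (continuous_const_mul _)))
    ⟨a, ha, by simpa [hg] using hb⟩
  have h1 : x ∈ A := (eq_iff_iff.1 hxA).2 hxu
  have h2 : g⁻¹ * x ∈ A := (eq_iff_iff.1 hgxA).2 hgxu
  exact ⟨x, h1, (g⁻¹ * x)⁻¹, by simpa using h2, by simp [hg]⟩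

/-- A continuous bijective homomorphism between Polish groups is a homeomorphism: the image of an
open set is Borel by Lusin–Souslin, and nonmeagre if nonempty, because countably many of its
translates cover the group, so that Pettis' theorem applies. -/
theorem MonoidHom.isInducing_of_bijective_polish {P Q : Type*} [Group P] [TopologicalSpace P]
    [IsTopologicalGroup P] [PolishSpace P] [Group Q] [TopologicalSpace Q]
    [IsTopologicalGroup Q] [PolishSpace Q] {f : P →* Q} (hf : Continuous f)
    (hb : Function.Bijective f) : IsInducing f := by
  rw [IsTopologicalGroup.isInducing_iff_nhds_one]
  refine le_antisymm (by simpa using (hf.tendsto 1).le_comap) fun U hU => ?_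
  have hdiv : Tendsto (fun p : P × P => p.1 * p.2⁻¹) (𝓝 1 ×ˢ 𝓝 1) (𝓝 1) := by
    have : Continuous fun p : P × P => p.1 * p.2⁻¹ := by fun_prop
    simpa [nhds_prod_eq] using this.tendsto (1, 1)
  obtain ⟨V', hV', hVU⟩ := mem_prod_same_iff.1 (hdiv hU)
  obtain ⟨V, hVV', hVo, hV1⟩ := mem_nhds_iff.1 hV'
  borelize P
  borelize Q
  have hmeas : MeasurableSet (f '' V) :=
    hVo.measurableSet.image_of_continuousOn_injOn hf.continuousOn hb.1.injOn
  obtain ⟨D, hDc, hDd⟩ := TopologicalSpace.exists_countable_dense P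
  have hm : ¬ IsMeagre (f '' V) := fun hm => by
    have : Countable D := hDc
    have hall : IsMeagre (⋃ d : D, (fun q => (f d)⁻¹ * q) ⁻¹' (f '' V)) :=
      isMeagre_iUnion fun d =>
        hm.preimage_of_isOpenMap (continuous_const_mul _) (isOpenMap_mul_left _)
    refine not_isMeagre_of_isOpen isOpen_univ ⟨(1 : Q), mem_univ _⟩
      (hall.mono fun q _ => ?_)
    obtain ⟨p, rfl⟩ := hb.2 q
    obtain ⟨d, hdV, hdD⟩ := hDd.inter_open_nonempty ((fun d => d⁻¹ * p) ⁻¹' V)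
      (hVo.preimage (by fun_prop)) ⟨p, by simpa using hV1⟩
    exact mem_iUnion_of_mem ⟨d, hdD⟩ ⟨d⁻¹ * p, hdV, by simp⟩
  refine mem_comap.2 ⟨_, hmeas.baireMeasurableSet.mul_inv_mem_nhds_one hm, ?_⟩
  rintro x ⟨_, ⟨v, hv, rfl⟩, w, ⟨v', hv', hw⟩, hx⟩
  obtain rfl : x = v * v'⁻¹ := hb.1 (by
    rw [← hx, map_mul, map_inv, hw, inv_inv])
  exact hVU (mk_mem_prod (hVV' hv) (hVV' hv'))

theorem MonoidHom.isInducing_of_isClosed_range {P Q : Type*} [Group P] [TopologicalSpace P]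
    [IsTopologicalGroup P] [PolishSpace P] [Group Q] [TopologicalSpace Q]
    [IsTopologicalGroup Q] [PolishSpace Q] {f : P →* Q} (hf : Continuous f)
    (hinj : Function.Injective f) (hcl : IsClosed (Set.range f)) : IsInducing f := by
  have : PolishSpace f.range := 
    (IsClosed.polishSpace hcl : PolishSpace (Set.range f))
  exact IsInducing.subtypeVal.comp
    (MonoidHom.isInducing_of_bijective_polish (f := f.rangeRestrict) (hf.subtype_mk _)
      ⟨f.rangeRestrict_injective_iff.2 hinj, f.rangeRestrict_surjective⟩)

end OpenMapping

/-! ### Injectively closed groups -/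

section InjClosed

/-- An `ω`-narrow group with a countably generated filter separating `1` injects continuously into a
Polish group, in such a way that the induced topology refines the filter at `1`. -/
theorem IsOmegaNarrow.exists_polish_group_of_filter {X : Type u} [Group X] [TopologicalSpace X]
    [IsTopologicalGroup X] (hn : IsOmegaNarrow X) (F : Filter X) [F.IsCountablyGenerated]
    (hF : 𝓝 1 ≤ F) (hker : F.ker ⊆ {1}) :
    ∃ (Y : Type u) (_ : Group Y) (_ : TopologicalSpace Y), ClassPG Y ∧
      ∃ f : X →* Y, Continuous f ∧ Function.Injective f ∧ comap f (𝓝 1) ≤ F := by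
  obtain ⟨τ, hg, h2, hc, hle, h1⟩ := hn.exists_coarser F hF hker
  obtain ⟨Y, gY, tY, hY, i, hi, hinj⟩ := @exists_polish_group_isInducing X _ τ hg h2 hc
  refine ⟨Y, gY, tY, hY, i, continuous_le_dom hle hi.continuous, hinj, ?_⟩
  rwa [← map_one i, ← hi.nhds_eq_comap]

theorem HasCountablePseudocharacter.exists_filter {X : Type u} [Group X] [TopologicalSpace X]
    (hp : HasCountablePseudocharacter X) :
    ∃ F : Filter X, F.IsCountablyGenerated ∧ 𝓝 1 ≤ F ∧ F.ker ⊆ {1} := by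
  obtain ⟨𝒰, hc, ho, hi⟩ := hp 1
  have h1 : (1 : X) ∈ ⋂₀ 𝒰 := hi ▸ mem_singleton _
  exact ⟨generate 𝒰, ⟨𝒰, hc, rfl⟩, le_generate_iff.2 fun U hU => (ho U hU).mem_nhds (h1 U hU),
    fun x hx => hi ▸ fun U hU => mem_ker.1 hx U (mem_generate_of_mem hU)⟩

/-- All continuous injections into Polish groups induce the same topology on `X`, as is seen by
comparing two of them with their product; hence each of them is a closed embedding. -/
theorem IsInjClosed.polishSpace {X : Type u} [Group X] [TopologicalSpace X]
    [IsTopologicalGroup X] (hn : IsOmegaNarrow X) (hp : HasCountablePseudocharacter X)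
    (hX : IsInjClosed ClassPG X) : PolishSpace X := by
  obtain ⟨F, hFc, hF, hker⟩ := hp.exists_filter
  obtain ⟨Y, gY, tY, hY, f, hf, hfi, -⟩ := hn.exists_polish_group_of_filter F hF hker
  have := hY.1
  have := hY.2
  have hcl := hX Y hY f hf hfi
  suffices hind : IsInducing f from
    (IsClosedEmbedding.mk ⟨hind, hfi⟩ hcl).polishSpace
  rw [IsTopologicalGroup.isInducing_iff_nhds_one]
  refine le_antisymm (by simpa using (hf.tendsto 1).le_comap) fun U hU => ?_
  obtain ⟨Z, gZ, tZ, hZ, g, hg, hgi, hgU⟩ := hn.exists_polish_group_of_filter (F ⊓ 𝓟 U)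
    (le_inf hF (le_principal_iff.2 hU)) ((ker_mono inf_le_left).trans hker)
  have := hZ.1
  have := hZ.2
  have hfg : Continuous (f.prod g) := hf.prodMk hg
  have hfgi : Function.Injective (f.prod g) := fun x y hxy => hfi (congrArg Prod.fst hxy)
  have hR : IsClosed (range (f.prod g)) :=
    hX (Y × Z) ⟨inferInstance, inferInstance⟩ (f.prod g) hfg hfgi
  have : PolishSpace (f.prod g).range := 
    (IsClosed.polishSpace hR : PolishSpace (range (f.prod g)))
  let φ : (f.prod g).range →* Y := (MonoidHom.fst Y Z).comp (f.prod g).range.subtype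
  have hφi : Function.Injective φ := by
    rintro ⟨_, x, rfl⟩ ⟨_, y, rfl⟩ hxy
    obtain rfl := hfi hxy
    rfl
  have hφr : range φ = range f := by
    ext y
    constructor
    · rintro ⟨⟨_, x, rfl⟩, rfl⟩
      exact ⟨x, rfl⟩
    · rintro ⟨x, rfl⟩
      exact ⟨⟨_, x, rfl⟩, rfl⟩
  have hφ : IsInducing φ := MonoidHom.isInducing_of_isClosed_range
    (continuous_fst.comp continuous_subtype_val) hφi (hφr ▸ hcl)
  have h1 : comap f (𝓝 1) = comap (f.prod g).rangeRestrict (𝓝 1) := by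
    rw [hφ.nhds_eq_comap, comap_comap, map_one]
    rfl
  rw [h1]
  have h2 : Tendsto (fun x => g x) (comap (f.prod g).rangeRestrict (𝓝 1)) (𝓝 1) :=
    ((continuous_snd.comp continuous_subtype_val).tendsto (1 : (f.prod g).range)).comp
      tendsto_comap
  exact (h2.le_comap.trans hgU) (mem_inf_of_right (mem_principal_self U))

theorem IsOmegaNarrow.of_surjective {X Y : Type u} [Group X] [TopologicalSpace X]
    [Group Y] [TopologicalSpace Y] (hn : IsOmegaNarrow X) {f : X →* Y} (hf : Continuous f)
    (hs : Function.Surjective f) : IsOmegaNarrow Y := fun U hU => by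
  obtain ⟨C, hC, hCU⟩ := hn (f ⁻¹' U) (hf.tendsto 1 (by simpa using hU))
  refine ⟨f '' C, hC.image f, eq_univ_of_forall fun y => ?_⟩
  obtain ⟨x, rfl⟩ := hs y
  obtain ⟨c, hc, u, hu, rfl⟩ : x ∈ C * f ⁻¹' U := hCU ▸ mem_univ x
  exact ⟨f c, mem_image_of_mem f hc, f u, hu, (map_mul f c u).symm⟩

/-- The complement of a point `y` is the image of a Lindelöf space, so it is covered by countably many
open sets that are disjoint from neighbourhoods of `y`. -/
theorem HasCountablePseudocharacter.of_continuous_surjective {X Y : Type u} [TopologicalSpace X]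
    [SecondCountableTopology X] [TopologicalSpace Y] [T2Space Y] {f : X → Y} (hf : Continuous f)
    (hs : Function.Surjective f) : HasCountablePseudocharacter Y := fun y => by
  choose! A hAo hyA B hBo hwB hAB using fun w (hw : w ≠ y) =>
    let ⟨A, B, hA, hB, hyA, hwB, hAB⟩ := t2_separation hw.symm
    (⟨A, hA, hyA, B, hB, hwB, hAB⟩ : ∃ A, IsOpen A ∧ y ∈ A ∧ ∃ B, IsOpen B ∧ w ∈ B ∧ Disjoint A B)
  obtain ⟨T, hT, hTu⟩ := TopologicalSpace.isOpen_iUnion_countable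
    (fun w : {w : Y // w ≠ y} => f ⁻¹' B w) fun w => (hBo w w.2).preimage hf
  refine ⟨(fun w : {w : Y // w ≠ y} => A w) '' T, hT.image _, ?_, ?_⟩
  · rintro _ ⟨w, -, rfl⟩
    exact hAo w w.2
  · refine Subset.antisymm (fun z hz => ?_) ?_
    · by_contra hzy
      obtain ⟨x, rfl⟩ := hs z
      have hx : x ∈ ⋃ w ∈ T, f ⁻¹' B w :=
        hTu ▸ mem_iUnion_of_mem (⟨f x, hzy⟩ : {w : Y // w ≠ y}) (hwB _ hzy)
      obtain ⟨w, hwT, hxw⟩ := mem_iUnion₂.1 hx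
      exact disjoint_left.1 (hAB w w.2) (hz _ ⟨w, hwT, rfl⟩) hxw
    · rintro _ rfl _ ⟨w, -, rfl⟩
      exact hyA w w.2

theorem IsInjClosed.isMinimalTopGroup {X : Type u} [Group X] [TopologicalSpace X]
    [IsTopologicalGroup X] [PolishSpace X] (hn : IsOmegaNarrow X)
    (hX : IsInjClosed ClassPG X) : IsMinimalTopGroup X := by
  intro Z _ _ hZ h hh hb
  have := hZ.1
  have := hZ.2
  obtain ⟨F, hFc, hF, hker⟩ :=
    (HasCountablePseudocharacter.of_continuous_surjective hh hb.2).exists_filter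
  obtain ⟨Y, gY, tY, hY, g, hg, hgi, -⟩ :=
    (hn.of_surjective hh hb.2).exists_polish_group_of_filter F hF hker
  have := hY.1
  have := hY.2
  have hgh : Continuous (g.comp h) := hg.comp hh
  have hghi : Function.Injective (g.comp h) := hgi.comp hb.1
  have hind : IsInducing (g ∘ h) :=
    MonoidHom.isInducing_of_isClosed_range hgh hghi (hX Y hY _ hgh hghi)
  exact (hind.of_comp hh hg).isOpenMap (by rw [hb.2.range_eq]; exact isOpen_univ)

end InjClosed

theorem theorem5p7 (X : Type u) [Group X] [TopologicalSpace X] [IsTopologicalGroup X]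
    [T2Space X] (hnarrow : IsOmegaNarrow X) (hpseudo : HasCountablePseudocharacter X) :
    List.TFAE
      [PolishSpace X ∧ IsMinimalTopGroup X,
       IsCompleteTopGroup X ∧ IsMinimalTopGroup X,
       IsInjClosed ClassTG X,
       IsInjClosed ClassPG X] := by
  tfae_have 1 → 2 := fun ⟨_, hm⟩ => ⟨IsCompleteTopGroup.of_isCompletelyMetrizableSpace, hm⟩
  tfae_have 2 → 3 := fun ⟨hc, hm⟩ Y _ _ hY f hf hfi => by
    have := hY.1
    have := hY.2
    exact hc.isClosed_range (hm.isInducing hf hfi)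
  tfae_have 3 → 4 := fun h Y _ _ hY f hf hfi => by
    have := hY.2
    exact h Y ⟨hY.1, inferInstance⟩ f hf hfi
  tfae_have 4 → 1 := fun h => by
    have := h.polishSpace hnarrow hpseudo
    exact ⟨this, h.isMinimalTopGroup hnarrow⟩
  tfae_finish
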